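/- Let $n\ge 2$ be an integer. There exists a compact set $E\subset\mathbb{R}^n$ of Hausdorff dimension exactly $n/2$ such that $E$ does not contain three distinct collinear points and, moreover, every direction is realised by $E$ at most once. Here a direction is a line through the origin in $\mathbb{R}^n$; it is realised by an unordered pair $\{x,y\}$ of distinct points of $E$ if it is spanned by $y-x$. The last assertion thus says: if $x\neq y$ and $z\neq v$ are points of $E$ such that $y-x$ and $v-z$ are parallel (nonzero real multiples of each other), then $\{x,y\}=\{z,v\}$. -/

import Mathlib

/-- The unordered pairs `{x, y}` of distinct points of `E` whose connecting line has direction `D`.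
A direction is a line through the origin (a point of projective space), so the vectors `y - x` and
`x - y` give the same direction. The direction `D` is realised by `E` at most once when this set
has at most one element. -/
def pairsRealising {V : Type*} [AddCommGroup V] [Module ℝ V] (E : Set V)
    (D : Projectivization ℝ V) : Set (Sym2 V) :=
  {p | ∃ x ∈ E, ∃ y ∈ E, ∃ hxy : x ≠ y,
    p = s(x, y) ∧ Projectivization.mk ℝ (y - x) (sub_ne_zero.mpr hxy.symm) = D}

open Filter Topology Set MeasureTheory
open scoped NNReal ENNReal

/-! Parallel pairs make the minor $(y_0-x_0)(v_1-z_1)-(y_1-x_1)(v_0-z_0)$ vanish, and parity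
prevents this. Write $N_k$ for `scale k`. Each coordinate of a point of $E$ lies within $1/(8N_k^2)$
of the lattice $N_k^{-1}\mathbb{Z}$, for every $k$, and the parity of its numerator may be
prescribed in terms of the earlier digits. If $y_0-x_0$ and $v_1-z_1$ have odd numerators and
$y_1-x_1$, $v_0-z_0$ even ones, the approximate minor is an odd integer over $N_k^2$; the
approximation error is smaller than $1/N_k^2$, so the true minor is nonzero. `cylinderRule` runs
through all pairs of cylinders, so each configuration gets these parities at some scale
(`minor_ne_zero`).

The dimension does not depend on the parities. Covering by $N_k^n$ boxes of side $N_k^{-2}$ gives at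
most $n/2$ (`dimH_point_image_le`). Since $N_k$ grows so fast that the number of $k$-digit prefixes
per coordinate is $N_k^{1-o(1)}$, the inverse of the coding of the unit cube is $r$-Hölder for every
$r<1/2$ (`exists_dist_le`), which gives at least $n/2$. -/

section

/-! ### Nested lattices and points with prescribed parities -/

/-- The denominators of the nested lattices. -/
def scale : ℕ → ℕ
  | 0 => 1
  | k + 1 => 32 * scale k ^ (k + 2)

/-- The number of values of the `k`-th digit of a coordinate. -/
def radix (k : ℕ) : ℕ := scale k ^ k

/-- The steps $2/N_{k+1}$, taken `radix k` times, cover length $1/(16N_k^2)$; later terms at most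
double this. -/
lemma scale_succ (k : ℕ) : scale (k + 1) = 32 * scale k ^ 2 * radix k := by
  rw [scale, radix]; ring

lemma scale_pos (k : ℕ) : 0 < scale k := by
  induction k with
  | zero => simp [scale]
  | succ k ih => rw [scale]; positivity

lemma scale_pos_real (k : ℕ) : (0 : ℝ) < scale k := by exact_mod_cast scale_pos k

lemma one_le_scale_real (k : ℕ) : (1 : ℝ) ≤ scale k := by exact_mod_cast scale_pos k

lemma radix_pos (k : ℕ) : 0 < radix k := pow_pos (scale_pos k) k

lemma two_mul_scale_dvd (k : ℕ) : 2 * scale k ∣ scale (k + 1) :=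
  ⟨16 * scale k ^ (k + 1), by rw [scale]; ring⟩

lemma two_mul_scale_le (k : ℕ) : 2 * scale k ≤ scale (k + 1) :=
  Nat.le_of_dvd (scale_pos _) (two_mul_scale_dvd k)

lemma two_pow_mul_scale_le (k l : ℕ) : 2 ^ l * scale k ≤ scale (k + l) := by
  induction l with
  | zero => simp
  | succ l ih =>
    calc 2 ^ (l + 1) * scale k = 2 * (2 ^ l * scale k) := by ring
      _ ≤ 2 * scale (k + l) := by gcongr
      _ ≤ scale (k + (l + 1)) := two_mul_scale_le _

variable {n : ℕ}

/-- Sequences of digit vectors. -/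
abbrev Digits (n : ℕ) := ℕ → Fin n → ℕ

/-- The admissible digit sequences: every `k`-th digit is less than `radix k`. -/
def admissible (n : ℕ) : Set (Digits n) := {d | ∀ k i, d k i < radix k}

/-- A parity rule prescribes the parities of the `k`-th lattice coordinates in terms of the
digits before the `k`-th one. -/
structure IsParityRule (a : ℕ → Digits n → Fin n → ℕ) : Prop where
  le_one : ∀ k d i, a k d i ≤ 1
  congr : ∀ k d d', (∀ l < k, d l = d' l) → a k d = a k d'

/-- The contribution of the `k`-th digit. -/
noncomputable def term (a : ℕ → Digits n → Fin n → ℕ) (d : Digits n) (i : Fin n) (k : ℕ) : ℝ :=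
  ((2 * d k i + a k d i : ℕ) : ℝ) / scale (k + 1)

/-- The point of `ℝⁿ` with the given digits. -/
noncomputable def point (a : ℕ → Digits n → Fin n → ℕ) (d : Digits n) : Fin n → ℝ :=
  fun i ↦ ∑' k, term a d i k

/-- The truncation of `point a d` to the first `k` digits. -/
noncomputable def partialPoint (a : ℕ → Digits n → Fin n → ℕ) (d : Digits n) (k : ℕ)
    (i : Fin n) : ℝ :=
  ∑ l ∈ Finset.range k, term a d i l

variable {a : ℕ → Digits n → Fin n → ℕ}

lemma term_nonneg (d : Digits n) (i : Fin n) (k : ℕ) : 0 ≤ term a d i k := by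
  unfold term; positivity

lemma term_le (ha : IsParityRule a) {d : Digits n} (hd : d ∈ admissible n) (i : Fin n) (k : ℕ) :
    term a d i k ≤ 1 / (16 * (scale k : ℝ) ^ 2) := by
  have h1 : 2 * d k i + a k d i ≤ 2 * radix k := by
    have := hd k i
    have := ha.le_one k d i
    omega
  have h1' : ((2 * d k i + a k d i : ℕ) : ℝ) ≤ 2 * radix k := by exact_mod_cast h1
  have hr : (0 : ℝ) < radix k := by exact_mod_cast radix_pos k
  have hs := scale_pos_real k
  unfold term
  rw [scale_succ, div_le_div_iff₀ (by push_cast; positivity) (by positivity)]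
  push_cast at h1' ⊢
  nlinarith [mul_le_mul_of_nonneg_right h1' (by positivity : (0 : ℝ) ≤ 16 * (scale k : ℝ) ^ 2)]

lemma term_add_le (ha : IsParityRule a) {d : Digits n} (hd : d ∈ admissible n) (i : Fin n)
    (k l : ℕ) : term a d i (k + l) ≤ 1 / (16 * (scale k : ℝ) ^ 2) * (1 / 2) ^ l := by
  refine (term_le ha hd i (k + l)).trans ?_
  have hs := scale_pos_real k
  have h1 : (2 : ℝ) ^ l * scale k ≤ scale (k + l) := by exact_mod_cast two_pow_mul_scale_le k l
  have h2 : (1 : ℝ) ≤ 2 ^ l := one_le_pow₀ (by norm_num)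
  rw [one_div_pow, ← one_div_mul_one_div_rev]
  rw [one_div_mul_one_div_rev, one_div_mul_one_div_rev]
  apply one_div_le_one_div_of_le (by positivity)
  have h3 : ((2 : ℝ) ^ l * scale k) ^ 2 ≤ (scale (k + l) : ℝ) ^ 2 := by gcongr
  have h4 : (2 : ℝ) ^ l * (scale k : ℝ) ^ 2 ≤ ((2 : ℝ) ^ l * scale k) ^ 2 := by
    rw [mul_pow, sq ((2 : ℝ) ^ l)]
    gcongr
    nlinarith
  nlinarith

lemma summable_term (ha : IsParityRule a) {d : Digits n} (hd : d ∈ admissible n) (i : Fin n) :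
    Summable (term a d i) := by
  refine Summable.of_nonneg_of_le (term_nonneg d i) (fun l ↦ ?_)
    (summable_geometric_two.mul_left (1 / (16 * (scale 0 : ℝ) ^ 2)))
  simpa using term_add_le ha hd i 0 l

/-- A point lies in the small box at its truncation. -/
lemma point_mem_Icc (ha : IsParityRule a) {d : Digits n} (hd : d ∈ admissible n) (k : ℕ)
    (i : Fin n) : point a d i ∈ Icc (partialPoint a d k i)
      (partialPoint a d k i + 1 / (8 * (scale k : ℝ) ^ 2)) := by
  have hsum := summable_term ha hd i
  have h : point a d i = partialPoint a d k i + ∑' l, term a d i (k + l) := by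
    rw [point, partialPoint, ← hsum.sum_add_tsum_nat_add k]
    simp_rw [add_comm k]
  have h0 : 0 ≤ ∑' l, term a d i (k + l) := tsum_nonneg fun l ↦ term_nonneg d i _
  have h1 : ∑' l, term a d i (k + l) ≤ 1 / (8 * (scale k : ℝ) ^ 2) := by
    have hg := summable_geometric_two.mul_left (1 / (16 * (scale k : ℝ) ^ 2))
    calc ∑' l, term a d i (k + l) ≤ ∑' l, 1 / (16 * (scale k : ℝ) ^ 2) * (1 / 2) ^ l :=
          Summable.tsum_le_tsum (term_add_le ha hd i k)
            (Summable.of_nonneg_of_le (fun l ↦ term_nonneg d i _) (term_add_le ha hd i k) hg) hg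
      _ = 1 / (8 * (scale k : ℝ) ^ 2) := by
          rw [tsum_mul_left, tsum_geometric_two]
          have := scale_pos_real k
          field_simp
          norm_num
  rw [h]
  exact ⟨by linarith, by linarith⟩

lemma point_mem_Icc_eighth (ha : IsParityRule a) {d : Digits n} (hd : d ∈ admissible n) (i : Fin n) :
    point a d i ∈ Icc (0 : ℝ) (1 / 8) := by
  simpa [partialPoint, scale] using point_mem_Icc ha hd 0 i

lemma partialPoint_succ (a : ℕ → Digits n → Fin n → ℕ) (d : Digits n) (k : ℕ) (i : Fin n) :
    partialPoint a d (k + 1) i = partialPoint a d k i + term a d i k :=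
  Finset.sum_range_succ _ _

lemma exists_partialPoint_eq (a : ℕ → Digits n → Fin n → ℕ) (d : Digits n) (k : ℕ) (i : Fin n) :
    ∃ q : ℕ, partialPoint a d k i = q / scale k := by
  induction k with
  | zero => exact ⟨0, by simp [partialPoint]⟩
  | succ k ih =>
    obtain ⟨q, hq⟩ := ih
    obtain ⟨c, hc⟩ := two_mul_scale_dvd k
    refine ⟨2 * c * q + (2 * d k i + a k d i), ?_⟩
    have h0 := scale_pos_real k
    have h1 := scale_pos_real (k + 1)
    rw [partialPoint_succ, hq, term, Nat.cast_add (2 * c * q), add_div]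
    congr 1
    rw [div_eq_div_iff h0.ne' h1.ne', hc]
    push_cast
    ring

/-- Because $2N_k$ divides $N_{k+1}$, the earlier terms contribute an even numerator, so the rule
alone decides the parity. -/
lemma exists_partialPoint_succ_eq (a : ℕ → Digits n → Fin n → ℕ) (d : Digits n) (k : ℕ)
    (i : Fin n) :
    ∃ q : ℤ, partialPoint a d (k + 1) i = ((2 * q + a k d i : ℤ) : ℝ) / scale (k + 1) := by
  obtain ⟨q, hq⟩ := exists_partialPoint_eq a d k i
  obtain ⟨c, hc⟩ := two_mul_scale_dvd k
  refine ⟨c * q + d k i, ?_⟩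
  have h0 := scale_pos_real k
  have h1 := scale_pos_real (k + 1)
  rw [partialPoint_succ, hq, term]
  have : (q : ℝ) / scale k = (2 * c * q) / scale (k + 1) := by
    rw [div_eq_div_iff h0.ne' h1.ne', hc]
    push_cast
    ring
  rw [this, ← add_div]
  push_cast
  ring

lemma partialPoint_congr (ha : IsParityRule a) {d d' : Digits n} {k : ℕ}
    (h : ∀ l < k, d l = d' l) (i : Fin n) : partialPoint a d k i = partialPoint a d' k i := by
  refine Finset.sum_congr rfl fun l hl ↦ ?_
  have hl := Finset.mem_range.1 hl
  rw [term, term, h l hl, ha.congr l d d' fun j hj ↦ h j (hj.trans hl)]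

/-- Points whose digits first differ at the `k`-th place are separated. -/
lemma abs_digit_sub_div_le (ha : IsParityRule a) {d d' : Digits n} (hd : d ∈ admissible n)
    (hd' : d' ∈ admissible n) {k : ℕ} (h : ∀ l < k, d l = d' l) (i : Fin n) :
    |(d k i : ℝ) - d' k i| / scale (k + 1) ≤ |point a d i - point a d' i| := by
  by_cases hne : d k i = d' k i
  · simp [hne]
  have h1 : (1 : ℝ) ≤ |(d k i : ℝ) - d' k i| := by
    have : (1 : ℤ) ≤ |(d k i : ℤ) - d' k i| := Int.one_le_abs (by omega)
    exact_mod_cast this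
  have hs := one_le_scale_real (k + 1)
  obtain ⟨e1, e2⟩ := point_mem_Icc ha hd (k + 1) i
  obtain ⟨e3, e4⟩ := point_mem_Icc ha hd' (k + 1) i
  have hδ : 1 / (8 * (scale (k + 1) : ℝ) ^ 2) ≤ 1 / scale (k + 1) := by
    apply one_div_le_one_div_of_le (by positivity)
    nlinarith
  -- The parities at step `k` see only earlier digits, so they cancel. The factor 2 leaves room for
  -- the tails.
  have hp : partialPoint a d (k + 1) i - partialPoint a d' (k + 1) i
      = 2 * (((d k i : ℝ) - d' k i) / scale (k + 1)) := by
    rw [partialPoint_succ, partialPoint_succ, partialPoint_congr ha h i, term, term,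
      ha.congr k d d' h]
    push_cast
    ring
  have h2 : 1 / (scale (k + 1) : ℝ) ≤ |((d k i : ℝ) - d' k i) / scale (k + 1)| := by
    rw [abs_div, abs_of_pos (by positivity : (0 : ℝ) < scale (k + 1))]
    gcongr
  have h3 : |(d k i : ℝ) - d' k i| / scale (k + 1) = |((d k i : ℝ) - d' k i) / scale (k + 1)| := by
    rw [abs_div, abs_of_pos (by positivity : (0 : ℝ) < scale (k + 1))]
  rw [h3]
  generalize ((d k i : ℝ) - d' k i) / scale (k + 1) = w at *
  rcases abs_cases w with ⟨hw, _⟩ | ⟨hw, _⟩ <;>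
    rcases abs_cases (point a d i - point a d' i) with ⟨hv, _⟩ | ⟨hv, _⟩ <;> linarith

lemma exists_first_difference {d d' : Digits n} (h : d ≠ d') :
    ∃ k, (∀ l < k, d l = d' l) ∧ ∃ i, d k i ≠ d' k i := by
  have hex : ∃ k, d k ≠ d' k := Function.ne_iff.1 h
  classical
  refine ⟨Nat.find hex, fun l hl ↦ not_not.1 (Nat.find_min hex hl),
    Function.ne_iff.1 (Nat.find_spec hex)⟩

/-! ### Compactness -/

lemma continuousOn_point (ha : IsParityRule a) : ContinuousOn (point a) (admissible n) := by
  refine continuousOn_pi.2 fun i ↦ ?_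
  refine continuousOn_tsum (u := fun k ↦ 1 / (16 * (scale 0 : ℝ) ^ 2) * (1 / 2) ^ k) (fun k ↦ ?_)
    (summable_geometric_two.mul_left _) fun k d hd ↦ ?_
  -- Each term depends on finitely many discrete digits.
  · refine Continuous.continuousOn (IsLocallyConstant.continuous ?_)
    rw [IsLocallyConstant.iff_eventually_eq]
    intro d
    have hev : ∀ᶠ d' in 𝓝 d, ∀ l ∈ Iio (k + 1), d' l = d l := by
      rw [eventually_all_finite (Set.finite_Iio _)]
      intro l _
      have := (continuous_apply (A := fun _ : ℕ ↦ Fin n → ℕ) l).tendsto d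
      rw [nhds_discrete (Fin n → ℕ)] at this
      simpa using this
    filter_upwards [hev] with d' hd'
    rw [term, term, hd' k (by simp),
      ha.congr k d' d fun l hl ↦ hd' l (by simp only [mem_Iio]; omega)]
  · rw [Real.norm_of_nonneg (term_nonneg d i k)]
    simpa using term_add_le ha hd i 0 k

lemma isCompact_admissible (n : ℕ) : IsCompact (admissible n) := by
  have : admissible n = univ.pi fun k ↦ univ.pi fun _ ↦ Iio (radix k) := by
    ext d; simp [admissible, Set.mem_pi]
  rw [this]
  exact isCompact_univ_pi fun k ↦ isCompact_univ_pi fun _ ↦ (Set.finite_Iio _).isCompact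

lemma isCompact_point_image (ha : IsParityRule a) : IsCompact (point a '' admissible n) :=
  (isCompact_admissible n).image_of_continuousOn (continuousOn_point ha)

/-! ### Upper bound for the dimension -/

lemma le_scale (k : ℕ) : k ≤ scale k := by
  induction k with
  | zero => simp
  | succ k ih =>
    have := two_mul_scale_le k
    have := scale_pos k
    omega

lemma tendsto_scale_sq_inv : Tendsto (fun k ↦ ((scale k : ℝ≥0∞) ^ 2)⁻¹) atTop (𝓝 0) := by
  have h : Tendsto (fun k ↦ scale k ^ 2) atTop atTop :=
    tendsto_atTop_mono (fun k ↦ (le_scale k).trans (Nat.le_self_pow two_ne_zero _)) tendsto_id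
  have := ENNReal.tendsto_inv_nat_nhds_zero.comp h
  simpa [Function.comp_def] using this

/-- Counting boxes bounds the dimension from above. -/
lemma dimH_point_image_le (ha : IsParityRule a) :
    dimH (point a '' admissible n) ≤ (n : ℝ≥0∞) / 2 := by
  let t : ∀ k : ℕ, (Fin n → Fin (scale k)) → Set (Fin n → ℝ) := fun k q ↦
    univ.pi fun i ↦ Icc ((q i : ℝ) / scale k) ((q i : ℝ) / scale k + 1 / (scale k : ℝ) ^ 2)
  have hdiam : ∀ k q, Metric.ediam (t k q) ≤ ((scale k : ℝ≥0∞) ^ 2)⁻¹ := by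
    intro k q
    refine Metric.ediam_le fun x hx y hy ↦ ?_
    have hs := scale_pos_real k
    have hd : dist x y ≤ 1 / (scale k : ℝ) ^ 2 := by
      refine (dist_pi_le_iff (by positivity)).2 fun i ↦ ?_
      simpa using Real.dist_le_of_mem_Icc (hx i trivial) (hy i trivial)
    rw [edist_dist]
    refine (ENNReal.ofReal_le_ofReal hd).trans (le_of_eq ?_)
    rw [one_div, ENNReal.ofReal_inv_of_pos (by positivity), ENNReal.ofReal_pow hs.le,
      ENNReal.ofReal_natCast]
  have hcover : ∀ k, point a '' admissible n ⊆ ⋃ q, t k q := by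
    rintro k _ ⟨d, hd, rfl⟩
    choose q hq using exists_partialPoint_eq a d k
    have hs := one_le_scale_real k
    have hmem := point_mem_Icc ha hd k
    have hlt : ∀ i, q i < scale k := by
      intro i
      have h1 := (hmem i).1
      have h2 := (point_mem_Icc_eighth ha hd i).2
      have h3 : (q i : ℝ) / scale k < 1 := by rw [← hq i]; linarith
      rw [div_lt_one (by linarith)] at h3
      exact_mod_cast h3
    refine mem_iUnion.2 ⟨fun i ↦ ⟨q i, hlt i⟩, fun i _ ↦ ?_⟩
    have h1 := hmem i
    rw [hq i] at h1
    refine ⟨h1.1, h1.2.trans ?_⟩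
    gcongr
    nlinarith
  have hμ : μH[((n / 2 : ℝ≥0) : ℝ)] (point a '' admissible n) ≤ 1 := by
    refine (Measure.hausdorffMeasure_le_liminf_sum _ _ _ tendsto_scale_sq_inv t
      (Eventually.of_forall hdiam) (Eventually.of_forall hcover)).trans ?_
    refine (liminf_le_liminf (v := fun _ ↦ (1 : ℝ≥0∞)) (Eventually.of_forall fun k ↦ ?_)).trans
      (by simp)
    calc ∑ q, Metric.ediam (t k q) ^ ((n / 2 : ℝ≥0) : ℝ)
        ≤ ∑ _q : Fin n → Fin (scale k), (((scale k : ℝ≥0∞) ^ 2)⁻¹) ^ ((n / 2 : ℝ≥0) : ℝ) := by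
          gcongr with q
          exact hdiam k q
      _ = (scale k : ℝ≥0∞) ^ n * ((scale k : ℝ≥0∞) ^ n)⁻¹ := by
          rw [Finset.sum_const, Finset.card_univ, Fintype.card_fun, Fintype.card_fin,
            Fintype.card_fin, nsmul_eq_mul, Nat.cast_pow, ENNReal.inv_rpow,
            ← ENNReal.rpow_natCast _ 2, ← ENNReal.rpow_mul]
          congr 2
          rw [← ENNReal.rpow_natCast]
          congr 1
          push_cast
          ring
      _ ≤ 1 := ENNReal.mul_inv_le_one _
  have := dimH_le_of_hausdorffMeasure_ne_top (ne_top_of_le_ne_top ENNReal.one_ne_top hμ)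
  refine this.trans (le_of_eq ?_)
  rw [ENNReal.coe_div two_ne_zero]
  simp

/-! ### Lower bound for the dimension by coding the unit cube -/

/-- The number of cells of the `k`-th subdivision of the unit interval. -/
def cells (k : ℕ) : ℕ := ∏ l ∈ Finset.range k, radix l

lemma cells_succ (k : ℕ) : cells (k + 1) = cells k * radix k := Finset.prod_range_succ _ _

lemma cells_pos (k : ℕ) : 0 < cells k := Finset.prod_pos fun l _ ↦ radix_pos l

lemma radix_le_cells (k : ℕ) : radix k ≤ cells (k + 1) := by
  rw [cells_succ]; exact Nat.le_mul_of_pos_left _ (cells_pos k)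

lemma le_cells (k : ℕ) : k ≤ cells (k + 2) :=
  calc k ≤ k + 1 := by omega
    _ ≤ scale (k + 1) := le_scale _
    _ ≤ radix (k + 1) := Nat.le_self_pow (by omega) _
    _ ≤ cells (k + 2) := radix_le_cells _

/-- The mixed radix digits of a point of the unit cube. -/
noncomputable def digitsOf (t : Fin n → ℝ) : Digits n :=
  fun k i ↦ ⌊(cells (k + 1) : ℝ) * t i⌋₊ % radix k

lemma digitsOf_mem (t : Fin n → ℝ) : digitsOf t ∈ admissible n :=
  fun k _ ↦ Nat.mod_lt _ (radix_pos k)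

lemma floor_cells_succ (t : Fin n → ℝ) (k : ℕ) (i : Fin n) :
    ⌊(cells (k + 1) : ℝ) * t i⌋₊ = radix k * ⌊(cells k : ℝ) * t i⌋₊ + digitsOf t k i := by
  have hr : (radix k : ℝ) ≠ 0 := by exact_mod_cast (radix_pos k).ne'
  have h : (cells k : ℝ) * t i = (cells (k + 1) : ℝ) * t i / radix k := by
    rw [cells_succ]; push_cast; field_simp
  rw [h, Nat.floor_div_natCast, digitsOf, Nat.div_add_mod]

lemma floor_cells_congr {t t' : Fin n → ℝ} (ht : ∀ i, t i ∈ Ico (0 : ℝ) 1)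
    (ht' : ∀ i, t' i ∈ Ico (0 : ℝ) 1) {k : ℕ} (h : ∀ l < k, digitsOf t l = digitsOf t' l)
    (i : Fin n) : ⌊(cells k : ℝ) * t i⌋₊ = ⌊(cells k : ℝ) * t' i⌋₊ := by
  induction k with
  | zero =>
    simp [cells, Nat.floor_eq_zero.2 (ht i).2, Nat.floor_eq_zero.2 (ht' i).2]
  | succ k ih =>
    rw [floor_cells_succ, floor_cells_succ, ih fun l hl ↦ h l (by omega), h k (by omega)]

lemma abs_sub_le_abs_floor_sub {u v : ℝ} (hu : 0 ≤ u) (hv : 0 ≤ v) :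
    |u - v| ≤ |(⌊u⌋₊ : ℝ) - ⌊v⌋₊| + 1 := by
  have h1 := Nat.floor_le hu
  have h2 := Nat.floor_le hv
  have h3 := Nat.lt_floor_add_one u
  have h4 := Nat.lt_floor_add_one v
  rcases abs_cases (u - v) with ⟨h, _⟩ | ⟨h, _⟩ <;>
    rcases abs_cases ((⌊u⌋₊ : ℝ) - ⌊v⌋₊) with ⟨h', _⟩ | ⟨h', _⟩ <;> linarith

lemma abs_sub_le_of_digitsOf {t t' : Fin n → ℝ} (ht : ∀ i, t i ∈ Ico (0 : ℝ) 1)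
    (ht' : ∀ i, t' i ∈ Ico (0 : ℝ) 1) {k : ℕ} (h : ∀ l < k, digitsOf t l = digitsOf t' l)
    (i : Fin n) :
    |t i - t' i| ≤ (|(digitsOf t k i : ℝ) - digitsOf t' k i| + 1) / cells (k + 1) := by
  have hc : (0 : ℝ) < cells (k + 1) := by exact_mod_cast cells_pos (k + 1)
  rw [le_div_iff₀ hc]
  have h1 := abs_sub_le_abs_floor_sub (mul_nonneg hc.le (ht i).1) (mul_nonneg hc.le (ht' i).1)
  rw [← mul_sub, abs_mul, abs_of_pos hc, floor_cells_succ t, floor_cells_succ t',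
    floor_cells_congr ht ht' h i] at h1
  push_cast at h1
  rw [add_sub_add_left_eq_sub] at h1
  linarith

lemma digitsOf_injOn {t t' : Fin n → ℝ} (ht : ∀ i, t i ∈ Ico (0 : ℝ) 1)
    (ht' : ∀ i, t' i ∈ Ico (0 : ℝ) 1) (h : digitsOf t = digitsOf t') : t = t' := by
  funext i
  by_contra hne
  have hpos : 0 < |t i - t' i| := abs_pos.2 (sub_ne_zero.2 hne)
  obtain ⟨k, hk⟩ := exists_nat_gt (1 / |t i - t' i|)
  have hle := abs_sub_le_of_digitsOf ht ht' (k := k + 1) (fun l _ ↦ by rw [h]) i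
  have hc : (k : ℝ) ≤ cells (k + 1 + 1) := by exact_mod_cast le_cells k
  have hc0 : (0 : ℝ) < cells (k + 1 + 1) := by exact_mod_cast cells_pos _
  rw [h, sub_self, abs_zero, zero_add, le_div_iff₀ hc0] at hle
  rw [div_lt_iff₀ hpos] at hk
  nlinarith

/-- The last radix alone suffices: `cells (j + 1)` is at least $N_j^j$, while $N_{j+1}^{2r}\le
32N_j^{2r(j+2)}$, and $2r(j+2)\le j$ for large $j$. The finite sum in the constant absorbs small
indices. -/
lemma exists_scale_rpow_le {r : ℝ} (hr0 : 0 < r) (hr : r < 1 / 2) :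
    ∃ K : ℝ, 0 < K ∧ ∀ k, (scale k : ℝ) ^ (2 * r) ≤ K * cells k := by
  obtain ⟨j₀, hj₀⟩ := exists_nat_gt (4 * r / (1 - 2 * r))
  have hj₀' : 4 * r < j₀ * (1 - 2 * r) := (div_lt_iff₀ (by linarith)).1 hj₀
  have hnn : ∀ k, 0 ≤ (scale k : ℝ) ^ (2 * r) := fun k ↦ by positivity
  have hsum : 0 ≤ ∑ k ∈ Finset.range (j₀ + 1), (scale k : ℝ) ^ (2 * r) :=
    Finset.sum_nonneg fun k _ ↦ hnn k
  refine ⟨32 + ∑ k ∈ Finset.range (j₀ + 1), (scale k : ℝ) ^ (2 * r), by linarith, fun k ↦ ?_⟩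
  have hc : (1 : ℝ) ≤ cells k := by exact_mod_cast cells_pos k
  rcases lt_or_ge k (j₀ + 1) with hk | hk
  · have := Finset.single_le_sum (f := fun k ↦ (scale k : ℝ) ^ (2 * r)) (fun k _ ↦ hnn k)
      (Finset.mem_range.2 hk)
    nlinarith
  · obtain ⟨j, rfl⟩ : ∃ j, k = j + 1 := ⟨k - 1, by omega⟩
    have hj : (j₀ : ℝ) ≤ j := by exact_mod_cast (by omega : j₀ ≤ j)
    have hs := one_le_scale_real j
    have h1 : (scale (j + 1) : ℝ) ^ (2 * r) ≤ 32 * (scale j : ℝ) ^ j := by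
      rw [scale]
      push_cast
      rw [Real.mul_rpow (by norm_num) (by positivity), ← Real.rpow_natCast_mul (by positivity)]
      have h32 : (32 : ℝ) ^ (2 * r) ≤ 32 ^ (1 : ℝ) :=
        Real.rpow_le_rpow_of_exponent_le (by norm_num) (by linarith)
      rw [Real.rpow_one] at h32
      have h2 : (scale j : ℝ) ^ (((j + 2 : ℕ) : ℝ) * (2 * r)) ≤ (scale j : ℝ) ^ (j : ℝ) := by
        refine Real.rpow_le_rpow_of_exponent_le hs ?_
        push_cast
        nlinarith
      rw [Real.rpow_natCast] at h2
      gcongr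
    have h2 : (scale j : ℝ) ^ j ≤ cells (j + 1) := by exact_mod_cast radix_le_cells j
    nlinarith

/-- The inverse of the coding of the unit cube is Hölder continuous. -/
lemma exists_dist_le (ha : IsParityRule a) {r : ℝ} (hr0 : 0 < r) (hr : r < 1 / 2) :
    ∃ C : ℝ, 0 < C ∧ ∀ t t' : Fin n → ℝ, (∀ i, t i ∈ Ico (0 : ℝ) 1) →
      (∀ i, t' i ∈ Ico (0 : ℝ) 1) →
      dist t t' ≤ C * dist (point a (digitsOf t)) (point a (digitsOf t')) ^ r := by
  obtain ⟨K, hK, hKc⟩ := exists_scale_rpow_le hr0 hr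
  -- The factor 64 is 2 from $J+1\le 2J$ times 32 from $32^r\le 32$.
  refine ⟨64 * K, by linarith, fun t t' ht ht' ↦ ?_⟩
  by_cases hne : digitsOf t = digitsOf t'
  · rw [digitsOf_injOn ht ht' hne, dist_self]
    positivity
  obtain ⟨k, hk, i₁, hi₁⟩ := exists_first_difference hne
  obtain ⟨m, -, hm⟩ := Finset.exists_max_image Finset.univ
    (fun i ↦ |(digitsOf t k i : ℝ) - digitsOf t' k i|) ⟨i₁, Finset.mem_univ i₁⟩
  set J := |(digitsOf t k m : ℝ) - digitsOf t' k m| with hJ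
  have hJ1 : 1 ≤ J := by
    refine le_trans ?_ (hm i₁ (Finset.mem_univ _))
    have : (1 : ℤ) ≤ |(digitsOf t k i₁ : ℤ) - digitsOf t' k i₁| := Int.one_le_abs (by omega)
    exact_mod_cast this
  have hJr : J ≤ radix k := by
    have h1 : (digitsOf t k m : ℝ) ≤ radix k := by exact_mod_cast (digitsOf_mem t k m).le
    have h2 : (digitsOf t' k m : ℝ) ≤ radix k := by exact_mod_cast (digitsOf_mem t' k m).le
    have h3 : (0 : ℝ) ≤ digitsOf t k m := by positivity
    have h4 : (0 : ℝ) ≤ digitsOf t' k m := by positivity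
    exact abs_le.2 ⟨by linarith, by linarith⟩
  have hR : (0 : ℝ) < radix k := by exact_mod_cast radix_pos k
  have hP : (0 : ℝ) < cells k := by exact_mod_cast cells_pos k
  have hs := scale_pos_real k
  have hfar : J / scale (k + 1) ≤ dist (point a (digitsOf t)) (point a (digitsOf t')) :=
    (abs_digit_sub_div_le ha (digitsOf_mem t) (digitsOf_mem t') hk m).trans
      (dist_le_pi_dist (point a (digitsOf t)) (point a (digitsOf t')) m)
  have hy : (0 : ℝ) < J / radix k := by positivity
  have hy1 : J / radix k ≤ 1 := (div_le_one hR).2 hJr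
  have hclose : dist t t' ≤ 2 * (J / radix k) / cells k := by
    refine (dist_pi_le_iff (by positivity)).2 fun i ↦ ?_
    rw [Real.dist_eq]
    refine (abs_sub_le_of_digitsOf ht ht' hk i).trans ?_
    rw [cells_succ, mul_div_assoc', div_div, mul_comm (cells k)]
    push_cast
    gcongr
    have := hm i (Finset.mem_univ _)
    linarith
  have hden : (32 * (scale k : ℝ) ^ 2) ^ r ≤ 32 * K * cells k := by
    rw [Real.mul_rpow (by norm_num) (by positivity), ← Real.rpow_natCast_mul hs.le]
    have h32 : (32 : ℝ) ^ r ≤ 32 ^ (1 : ℝ) :=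
      Real.rpow_le_rpow_of_exponent_le (by norm_num) (by linarith)
    rw [Real.rpow_one] at h32
    have := hKc k
    calc (32 : ℝ) ^ r * (scale k : ℝ) ^ (((2 : ℕ) : ℝ) * r)
        ≤ 32 * (K * cells k) := by push_cast; gcongr
      _ = 32 * K * cells k := by ring
  have hyr : J / radix k ≤ (J / radix k) ^ r := by
    simpa using Real.rpow_le_rpow_of_exponent_ge hy hy1 (by linarith : r ≤ 1)
  have hdpos : 0 < (32 * (scale k : ℝ) ^ 2) ^ r := by positivity
  calc dist t t' ≤ 2 * (J / radix k) / cells k := hclose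
    _ ≤ 2 * (J / radix k) ^ r / cells k := by gcongr
    _ ≤ 64 * K * ((J / radix k) ^ r / (32 * (scale k : ℝ) ^ 2) ^ r) := by
        rw [mul_div_assoc', div_le_div_iff₀ hP hdpos]
        nlinarith [mul_le_mul_of_nonneg_left hden (Real.rpow_nonneg hy.le r)]
    _ = 64 * K * (J / scale (k + 1)) ^ r := by
        rw [← Real.div_rpow hy.le (by positivity), scale_succ, div_div, mul_comm (radix k : ℝ)]
        push_cast
        rfl
    _ ≤ 64 * K * dist (point a (digitsOf t)) (point a (digitsOf t')) ^ r := by gcongr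

lemma dimH_pi_Ico (n : ℕ) : dimH (univ.pi fun _ : Fin n ↦ Ico (0 : ℝ) 1) = n := by
  rw [Real.dimH_of_nonempty_interior]
  · simp
  · refine ⟨fun _ ↦ 1 / 2, ?_⟩
    rw [interior_pi_set finite_univ]
    intro i _
    simp only [interior_Ico]
    norm_num

/-- An $r$-Hölder map sends a subset of the image onto the half-open cube, and such a map multiplies
dimension by at most $1/r$. -/
lemma mul_le_dimH_point_image (ha : IsParityRule a) {r : ℝ≥0} (hr0 : 0 < r)
    (hr : (r : ℝ) < 1 / 2) : (n : ℝ≥0∞) * r ≤ dimH (point a '' admissible n) := by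
  obtain ⟨C, hC, h⟩ := exists_dist_le ha (NNReal.coe_pos.2 hr0) hr
  lift C to ℝ≥0 using hC.le
  set Q := univ.pi fun _ : Fin n ↦ Ico (0 : ℝ) 1
  let g : (Fin n → ℝ) → Fin n → ℝ := fun t ↦ point a (digitsOf t)
  have hr' : (r : ℝ) ≠ 0 := by exact_mod_cast hr0.ne'
  have hinj : InjOn g Q := by
    intro t ht t' ht' heq
    have := h t t' (fun i ↦ ht i trivial) (fun i ↦ ht' i trivial)
    simp only [g] at heq
    rw [heq, dist_self, Real.zero_rpow hr', mul_zero] at this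
    exact dist_le_zero.1 this
  have hleft := hinj.leftInvOn_invFunOn
  have hf : HolderOnWith C r (Function.invFunOn g Q) (g '' Q) := by
    rintro _ ⟨t, ht, rfl⟩ _ ⟨t', ht', rfl⟩
    rw [hleft ht, hleft ht', edist_nndist, edist_nndist,
      ← ENNReal.coe_rpow_of_nonneg _ r.coe_nonneg]
    norm_cast
    exact h t t' (fun i ↦ ht i trivial) (fun i ↦ ht' i trivial)
  have h1 := hf.dimH_image_le hr0
  rw [hleft.image_image, dimH_pi_Ico] at h1
  have h2 : dimH (g '' Q) ≤ dimH (point a '' admissible n) := by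
    refine dimH_mono ?_
    rintro _ ⟨t, _, rfl⟩
    exact ⟨_, digitsOf_mem t, rfl⟩
  refine le_trans ?_ h2
  rwa [ENNReal.le_div_iff_mul_le (by left; simpa using hr0.ne') (by simp)] at h1

lemma dimH_point_image (hn : 0 < n) (ha : IsParityRule a) :
    dimH (point a '' admissible n) = (n : ℝ≥0∞) / 2 := by
  refine le_antisymm (dimH_point_image_le ha) (ENNReal.le_of_forall_nnreal_lt fun c hc ↦ ?_)
  rcases eq_or_ne c 0 with rfl | hc0
  · simp
  have hn' : (n : ℝ≥0) ≠ 0 := by exact_mod_cast hn.ne'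
  have hc' : c < n / 2 := by
    rw [← ENNReal.coe_lt_coe, ENNReal.coe_div two_ne_zero]
    simpa using hc
  have hcr : (c : ℝ) < n / 2 := by exact_mod_cast hc'
  have hnr : (0 : ℝ) < n := by exact_mod_cast hn
  have h := mul_le_dimH_point_image (n := n) ha (r := c / n) (by positivity) (by
    push_cast
    rw [div_lt_iff₀ hnr]
    linarith)
  refine le_trans (le_of_eq ?_) h
  rw [← ENNReal.coe_natCast, ← ENNReal.coe_mul, mul_div_cancel₀ _ hn']

/-! ### The parity rule and nonvanishing minors -/

/-- A pair of digit prefixes of a common length. -/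
abbrev PrefixPair (n : ℕ) := Σ j : ℕ, (Fin j → Fin n → ℕ) × (Fin j → Fin n → ℕ)

/-- Late occurrences are needed because the rule at step `k` may inspect only prefixes of length at
most `k`. -/
lemma exists_recurrent_enumeration (T : Type*) [Countable T] [Nonempty T] :
    ∃ e : ℕ → T, ∀ t j, ∃ k, j ≤ k ∧ e k = t := by
  obtain ⟨s, hs⟩ := exists_surjective_nat T
  refine ⟨fun k ↦ s k.unpair.1, fun t j ↦ ?_⟩
  obtain ⟨i, rfl⟩ := hs t
  exact ⟨Nat.pair i j, Nat.right_le_pair i j, by simp⟩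

open Classical in
/-- The parity rule that at the `k`-th step makes the coordinate `i₀` odd on the first cylinder
of the pair `e k`, the coordinate `i₁` odd on the second one, and everything else even. -/
noncomputable def cylinderRule (e : ℕ → PrefixPair n) (i₀ i₁ : Fin n) (k : ℕ) (d : Digits n)
    (i : Fin n) : ℕ :=
  if (e k).1 ≤ k ∧ ((i = i₀ ∧ ∀ l : Fin (e k).1, d l = (e k).2.1 l) ∨
    (i = i₁ ∧ ∀ l : Fin (e k).1, d l = (e k).2.2 l)) then 1 else 0

lemma isParityRule_cylinderRule (e : ℕ → PrefixPair n) (i₀ i₁ : Fin n) :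
    IsParityRule (cylinderRule e i₀ i₁) where
  le_one k d i := by unfold cylinderRule; split_ifs <;> simp
  congr k d d' h := by
    funext i
    unfold cylinderRule
    by_cases hk : (e k).1 ≤ k
    · have : ∀ l : Fin (e k).1, d l = d' l := fun l ↦ h l (l.2.trans_le hk)
      simp only [this]
    · simp [hk]

lemma eventually_prefix_ne {d d' : Digits n} (h : d ≠ d') :
    ∀ᶠ j : ℕ in atTop, ¬ ∀ l : Fin j, d l = d' l := by
  obtain ⟨k, hk⟩ := Function.ne_iff.1 h
  filter_upwards [eventually_gt_atTop k] with j hj hall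
  exact hk (hall ⟨k, hj⟩)

/-- The direction minor does not vanish on configurations of points of the constructed set. -/
lemma minor_ne_zero {e : ℕ → PrefixPair n} (he : ∀ t j, ∃ k, j ≤ k ∧ e k = t) {i₀ i₁ : Fin n}
    (hi : i₀ ≠ i₁) {E : Set (Fin n → ℝ)} (hE : E = point (cylinderRule e i₀ i₁) '' admissible n)
    {x y z v : Fin n → ℝ} (hx : x ∈ E) (hy : y ∈ E) (hz : z ∈ E) (hv : v ∈ E)
    (hyx : y ≠ x) (hyz : y ≠ z) (hyv : y ≠ v) (hvx : v ≠ x) (hvz : v ≠ z) :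
    (y i₀ - x i₀) * (v i₁ - z i₁) - (y i₁ - x i₁) * (v i₀ - z i₀) ≠ 0 := by
  subst hE
  have ha := isParityRule_cylinderRule e i₀ i₁
  obtain ⟨x, hx, rfl⟩ := hx
  obtain ⟨y, hy, rfl⟩ := hy
  obtain ⟨z, hz, rfl⟩ := hz
  obtain ⟨v, hv, rfl⟩ := hv
  -- Prefixes of length `j` separate `y` and `v` from each other and from `x` and `z`; the points
  -- `x` and `z` may coincide.
  obtain ⟨j, ⟨hyx, hyz⟩, ⟨hyv, hvy⟩, hvx, hvz⟩ :=
    (((eventually_prefix_ne (ne_of_apply_ne _ hyx.symm)).and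
      (eventually_prefix_ne (ne_of_apply_ne _ hyz.symm))).and
      (((eventually_prefix_ne (ne_of_apply_ne _ hyv)).and
        (eventually_prefix_ne (ne_of_apply_ne _ hyv.symm))).and
      ((eventually_prefix_ne (ne_of_apply_ne _ hvx.symm)).and
      (eventually_prefix_ne (ne_of_apply_ne _ hvz.symm))))).exists
  obtain ⟨k, hjk, hk⟩ := he ⟨j, fun l ↦ y l, fun l ↦ v l⟩ j
  have val : ∀ d i, cylinderRule e i₀ i₁ k d i =
      @ite ℕ ((i = i₀ ∧ ∀ l : Fin j, d l = y l) ∨ (i = i₁ ∧ ∀ l : Fin j, d l = v l))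
        (Classical.propDecidable _) 1 0 := by
    intro d i
    unfold cylinderRule
    rw [hk]
    simp [hjk]
  have hx0 : cylinderRule e i₀ i₁ k x i₀ = 0 := by simp [val, hi, hyx]
  have hx1 : cylinderRule e i₀ i₁ k x i₁ = 0 := by simp [val, hi.symm, hvx]
  have hy0 : cylinderRule e i₀ i₁ k y i₀ = 1 := by simp [val]
  have hy1 : cylinderRule e i₀ i₁ k y i₁ = 0 := by simp [val, hi.symm, hyv]
  have hz0 : cylinderRule e i₀ i₁ k z i₀ = 0 := by simp [val, hi, hyz]
  have hz1 : cylinderRule e i₀ i₁ k z i₁ = 0 := by simp [val, hi.symm, hvz]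
  have hv0 : cylinderRule e i₀ i₁ k v i₀ = 0 := by simp [val, hi, hvy]
  have hv1 : cylinderRule e i₀ i₁ k v i₁ = 1 := by simp [val]
  set a := cylinderRule e i₀ i₁
  have hs := scale_pos_real (k + 1)
  have approx : ∀ d d', d ∈ admissible n → d' ∈ admissible n → ∀ i,
      ∃ q : ℤ, |point a d i - point a d' i
        - ((2 * q + a k d i - a k d' i : ℤ) : ℝ) / scale (k + 1)|
          ≤ 1 / (8 * (scale (k + 1) : ℝ) ^ 2) := by
    intro d d' hd hd' i
    obtain ⟨q, hq⟩ := exists_partialPoint_succ_eq a d k i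
    obtain ⟨q', hq'⟩ := exists_partialPoint_succ_eq a d' k i
    obtain ⟨h1, h2⟩ := point_mem_Icc ha hd (k + 1) i
    obtain ⟨h3, h4⟩ := point_mem_Icc ha hd' (k + 1) i
    refine ⟨q - q', ?_⟩
    have : ((2 * (q - q') + a k d i - a k d' i : ℤ) : ℝ) / scale (k + 1)
        = partialPoint a d (k + 1) i - partialPoint a d' (k + 1) i := by
      rw [hq, hq', ← sub_div]; push_cast; ring
    rw [this]
    exact abs_le.2 ⟨by linarith, by linarith⟩
  have small : ∀ d d', d ∈ admissible n → d' ∈ admissible n → ∀ i,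
      |point a d i - point a d' i| ≤ 1 / 8 := by
    intro d d' hd hd' i
    obtain ⟨h1, h2⟩ := point_mem_Icc_eighth ha hd i
    obtain ⟨h3, h4⟩ := point_mem_Icc_eighth ha hd' i
    exact abs_le.2 ⟨by linarith, by linarith⟩
  obtain ⟨p, hp⟩ := approx y x hy hx i₀
  obtain ⟨p', hp'⟩ := approx v z hv hz i₁
  obtain ⟨q, hq⟩ := approx y x hy hx i₁
  obtain ⟨q', hq'⟩ := approx v z hv hz i₀
  have sp := small y x hy hx i₀
  have sp' := small v z hv hz i₁
  have sq := small y x hy hx i₁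
  have sq' := small v z hv hz i₀
  rw [hy0, hx0] at hp
  rw [hv1, hz1] at hp'
  rw [hy1, hx1] at hq
  rw [hv0, hz0] at hq'
  generalize point a y i₀ - point a x i₀ = u at *
  generalize point a v i₁ - point a z i₁ = u' at *
  generalize point a y i₁ - point a x i₁ = w at *
  generalize point a v i₀ - point a z i₀ = w' at *
  have hs1 := one_le_scale_real (k + 1)
  have hodd : (1 : ℝ) ≤ |((2 * p + 1 : ℤ) : ℝ) * ((2 * p' + 1 : ℤ) : ℝ)
      - ((2 * q : ℤ) : ℝ) * ((2 * q' : ℤ) : ℝ)| := by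
    have : (1 : ℤ) ≤ |(2 * p + 1) * (2 * p' + 1) - (2 * q) * (2 * q')| := by
      refine Int.one_le_abs fun h ↦ ?_
      have : 2 * (2 * p * p' + p + p' - 2 * q * q') + 1 = 0 := by linarith
      omega
    exact_mod_cast this
  have hδ : 1 / (8 * (scale (k + 1) : ℝ) ^ 2) ≤ 1 / 8 := by
    apply one_div_le_one_div_of_le (by norm_num); nlinarith
  -- a product of two small numbers changes little under approximation
  have prod : ∀ s t s' t' δ : ℝ, |s| ≤ 1 / 8 → |t| ≤ 1 / 8 → |s - s'| ≤ δ → |t - t'| ≤ δ →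
      δ ≤ 1 / 8 → |s * t - s' * t'| ≤ 3 / 8 * δ := by
    intro s t s' t' δ h1 h2 h3 h4 h5
    have h6 : |t'| ≤ 1 / 4 := by
      rw [abs_le] at *
      exact ⟨by linarith, by linarith⟩
    calc |s * t - s' * t'| = |s * (t - t') + t' * (s - s')| := by ring_nf
      _ ≤ |s| * |t - t'| + |t'| * |s - s'| := by
        rw [← abs_mul, ← abs_mul]; exact abs_add_le _ _
      _ ≤ 1 / 8 * δ + 1 / 4 * δ := by gcongr
      _ = 3 / 8 * δ := by ring
  have e1 := prod u u' _ _ _ sp sp' hp hp' hδ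
  have e2 := prod w w' _ _ _ sq sq' hq hq' hδ
  intro h0
  -- If the minor vanished, the two product errors would bound a quantity of size at least
  -- $1/N_{k+1}^2$ by $\tfrac{3}{32}/N_{k+1}^2$.
  have key : |(((2 * p + 1 : ℤ) : ℝ) * ((2 * p' + 1 : ℤ) : ℝ)
      - ((2 * q : ℤ) : ℝ) * ((2 * q' : ℤ) : ℝ)) / (scale (k + 1) : ℝ) ^ 2|
      ≤ 3 / 4 * (1 / (8 * (scale (k + 1) : ℝ) ^ 2)) := by
    have : (((2 * p + 1 : ℤ) : ℝ) * ((2 * p' + 1 : ℤ) : ℝ)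
      - ((2 * q : ℤ) : ℝ) * ((2 * q' : ℤ) : ℝ)) / (scale (k + 1) : ℝ) ^ 2
      = (w * w' - ((2 * q + (0 : ℕ) - (0 : ℕ) : ℤ) : ℝ) / scale (k + 1) *
          (((2 * q' + (0 : ℕ) - (0 : ℕ) : ℤ) : ℝ) / scale (k + 1)))
        - (u * u' - ((2 * p + (1 : ℕ) - (0 : ℕ) : ℤ) : ℝ) / scale (k + 1) *
          (((2 * p' + (1 : ℕ) - (0 : ℕ) : ℤ) : ℝ) / scale (k + 1))) := by
      have huw : u * u' = w * w' := by linarith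
      rw [huw]
      push_cast
      field_simp
      ring
    rw [this]
    refine (abs_sub _ _).trans ?_
    linarith
  rw [abs_div, abs_of_pos (by positivity : (0 : ℝ) < (scale (k + 1) : ℝ) ^ 2)] at key
  have h2 := div_le_div_of_nonneg_right hodd
    (by positivity : (0 : ℝ) ≤ (scale (k + 1) : ℝ) ^ 2)
  have h3 : 3 / 4 * (1 / (8 * (scale (k + 1) : ℝ) ^ 2)) = 3 / 32 * (1 / (scale (k + 1) : ℝ) ^ 2) := by
    field_simp; norm_num
  have h4 : 0 < 1 / (scale (k + 1) : ℝ) ^ 2 := by positivity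
  linarith

end

/-! ### The set in Euclidean space -/

theorem theorem4p1 (n : ℕ) (hn : 2 ≤ n) :
    ∃ E : Set (EuclideanSpace ℝ (Fin n)),
      IsCompact E ∧
      dimH E = (n : ENNReal) / 2 ∧
      (∀ x ∈ E, ∀ y ∈ E, ∀ z ∈ E, x ≠ y → x ≠ z → y ≠ z →
        ¬ Collinear ℝ ({x, y, z} : Set (EuclideanSpace ℝ (Fin n)))) ∧
      (∀ D : Projectivization ℝ (EuclideanSpace ℝ (Fin n)), (pairsRealising E D).Subsingleton) := by
  let i₀ : Fin n := ⟨0, by omega⟩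
  let i₁ : Fin n := ⟨1, by omega⟩
  have hi : i₀ ≠ i₁ := by simp [i₀, i₁]
  obtain ⟨e, he⟩ := exists_recurrent_enumeration (PrefixPair n)
  have ha := isParityRule_cylinderRule e i₀ i₁
  let φ := EuclideanSpace.equiv (Fin n) ℝ
  set F := point (cylinderRule e i₀ i₁) '' admissible n with hF
  have avoid : ∀ x ∈ φ.symm '' F, ∀ y ∈ φ.symm '' F, ∀ z ∈ φ.symm '' F, ∀ v ∈ φ.symm '' F,
      y ≠ x → y ≠ z → y ≠ v → v ≠ x → v ≠ z →
      (y i₀ - x i₀) * (v i₁ - z i₁) ≠ (y i₁ - x i₁) * (v i₀ - z i₀) := by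
    rintro _ ⟨x, hx, rfl⟩ _ ⟨y, hy, rfl⟩ _ ⟨z, hz, rfl⟩ _ ⟨v, hv, rfl⟩ h1 h2 h3 h4 h5
    exact sub_ne_zero.1 (minor_ne_zero he hi hF hx hy hz hv (ne_of_apply_ne _ h1)
      (ne_of_apply_ne _ h2) (ne_of_apply_ne _ h3) (ne_of_apply_ne _ h4) (ne_of_apply_ne _ h5))
  refine ⟨φ.symm '' F, (isCompact_point_image ha).image φ.symm.continuous, ?_, ?_, ?_⟩
  · rw [ContinuousLinearEquiv.dimH_image]
    exact dimH_point_image (by omega) ha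
  · intro x hx y hy z hz hxy hxz hyz hcol
    obtain ⟨p, w, h⟩ := (collinear_iff_exists_forall_eq_smul_vadd _).1 hcol
    obtain ⟨r, rfl⟩ := h x (by simp)
    obtain ⟨s, rfl⟩ := h y (by simp)
    obtain ⟨t, rfl⟩ := h z (by simp)
    -- Collinearity makes two pairs with the common base point `x` parallel.
    refine avoid _ hx _ hy _ hx _ hz hxy.symm hxy.symm hyz hxz.symm hxz.symm ?_
    simp only [vadd_eq_add, PiLp.add_apply, PiLp.smul_apply, smul_eq_mul]
    ring
  · rintro D _ ⟨x, hx, y, hy, hxy, rfl, hD⟩ _ ⟨z, hz, v, hv, hzv, rfl, hD'⟩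
    by_contra hne
    obtain ⟨c, hc⟩ := (Projectivization.mk_eq_mk_iff' ℝ _ _ _ _).1 (hD.trans hD'.symm)
    have c0 : c * (v i₀ - z i₀) = y i₀ - x i₀ := congrArg (fun u ↦ u i₀) hc
    have c1 : c * (v i₁ - z i₁) = y i₁ - x i₁ := congrArg (fun u ↦ u i₁) hc
    have hpar : (y i₀ - x i₀) * (v i₁ - z i₁) = (y i₁ - x i₁) * (v i₀ - z i₀) := by
      rw [← c0, ← c1]; ring
    -- Distinct pairs share at most one point. Swapping endpoints makes a shared point the base of
    -- both pairs, the only coincidence `avoid` permits.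
    by_cases hyv : y = v
    · have hxz : x ≠ z := by rintro rfl; exact hne (by rw [hyv])
      exact avoid y hy x hx v hv z hz hxy (hyv ▸ hxy) hxz (hyv ▸ hzv) hzv (by linarith)
    by_cases hyz : y = z
    · have hxv : x ≠ v := by rintro rfl; exact hne (by rw [hyz, Sym2.eq_swap])
      exact avoid y hy x hx z hz v hv hxy (hyz ▸ hxy) hxv (Ne.symm hyv) hzv.symm (by linarith)
    by_cases hvx : v = x
    · exact avoid x hx y hy v hv z hz hxy.symm hyv hyz (hvx ▸ hzv) hzv (by linarith)
    · exact avoid x hx y hy z hz v hv hxy.symm hyz hyv hvx hzv.symm hpar
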